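/- Let $k$ be a field, $n\ge 0$ an integer and $L$ a lattice in $\mathbb{Z}^n$, that is, a subgroup of $\mathbb{Z}^n$ of any rank. Let $I_L=\langle x^u-x^v : u,v\in\mathbb{N}^n,\ u-v\in L\rangle\subseteq k[x_1,\ldots,x_n]$ be its lattice ideal. Let $\sigma\subseteq\{1,\ldots,n\}$ be the set of all indices $i$ such that $w_i\neq 0$ for some $w\in L\cap\mathbb{N}^n$. For $u\in\mathbb{Z}^n$ put $u^\sigma=(u_i)_{i\notin\sigma}$, let $L^\sigma=\{u^\sigma : u\in L\}\subseteq\mathbb{Z}^{\{1,\ldots,n\}\setminus\sigma}$, and let $I_{L^\sigma}$ be the lattice ideal of $L^\sigma$ (defined in the same way) in the polynomial ring $k[x_i : i\notin\sigma]$. An ideal of height $r$ is called a complete intersection if it is generated by $r$ elements, and an ideal of height $r$ in a polynomial ring is called a binomial complete intersection if it is generated by $r$ binomials, where a binomial is a polynomial of the form $x^u-x^v$. Then $I_L$ is a binomial complete intersection if and only if $I_{L^\sigma}$ is a complete intersection. -/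

import Mathlib

namespace LatticeIdeal

/-- A pure difference binomial `x^u - x^v` in `k[x_i : i ∈ ι]`. -/
def IsBinomial {ι k : Type*} [CommRing k] (f : MvPolynomial ι k) : Prop :=
  ∃ u v : ι →₀ ℕ, f = MvPolynomial.monomial u 1 - MvPolynomial.monomial v 1

/-- The lattice ideal `I_L = ⟨x^u - x^v : u - v ∈ L⟩` of `k[x_i : i ∈ ι]`, where `L` is a
lattice (a subgroup) in `ℤ^ι`. -/
noncomputable def latticeIdeal {ι : Type*} (k : Type*) [CommRing k] (L : AddSubgroup (ι → ℤ)) :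
    Ideal (MvPolynomial ι k) :=
  Ideal.span {f | ∃ u v : ι →₀ ℕ, (fun i => (u i : ℤ) - (v i : ℤ)) ∈ L ∧
    f = MvPolynomial.monomial u 1 - MvPolynomial.monomial v 1}

/-- `σ_L`, the union of the supports of the vectors in `L ∩ ℕ^ι`. -/
def posSupport {ι : Type*} (L : AddSubgroup (ι → ℤ)) : Set ι :=
  {i | ∃ w ∈ L, 0 ≤ w ∧ w i ≠ 0}

/-- For `s ⊆ ι`, the map `u ↦ u^s = (u_i)_{i ∉ s}` that forgets the coordinates in `s`. -/
def forget {ι : Type*} (s : Set ι) : (ι → ℤ) →+ ({i // i ∉ s} → ℤ) where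
  toFun u := fun i => u i.1
  map_zero' := rfl
  map_add' _ _ := rfl

/-- The lattice `L^σ`, `σ = σ_L`: the projection of `L` to the coordinates outside `σ`. -/
def outerLattice {ι : Type*} (L : AddSubgroup (ι → ℤ)) :
    AddSubgroup ({i // i ∉ posSupport L} → ℤ) :=
  L.map (forget (posSupport L))

/-- An ideal of height `r` is a complete intersection if it is generated by `r` elements. -/
def IsCompleteIntersection {R : Type*} [CommRing R] (I : Ideal R) : Prop :=
  ∃ (r : ℕ) (P : Fin r → R), I.height = r ∧ I = Ideal.span (Set.range P)

/-- An ideal of height `r` in a polynomial ring is a binomial complete intersection if it is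
generated by `r` binomials. -/
def IsBinomialCompleteIntersection {ι k : Type*} [CommRing k]
    (I : Ideal (MvPolynomial ι k)) : Prop :=
  ∃ (r : ℕ) (B : Fin r → MvPolynomial ι k),
    (∀ j, IsBinomial (B j)) ∧ I.height = r ∧ I = Ideal.span (Set.range B)

end LatticeIdeal

/-!
A congruence `r` on the monoid `ℕ^ι` can be recovered from the ideal `⟨x^u - x^v : r u v⟩`, so `I_L`
is generated by `m` binomials if and only if the congruence `u - v ∈ L` is generated by `m` pairs.
Since `I_L` has height `rank L`, being a binomial complete intersection is a property of this
congruence alone. It passes between `L` and `L^σ` because `rank L = rank L^σ + rank L_σ`, where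
`L_σ` consists of the vectors of `L` supported in `σ`.

* If pairs generate the congruence of `L`, the differences of those with difference in `L_σ`
  generate `L_σ`, so there are at least `rank L_σ` of them, and the other ones, restricted to the
  coordinates outside `σ`, generate the congruence of `L^σ`.
* Conversely, lifts of pairs for `L^σ` together with pairs for `L_σ` suffice for `L`. If `L_σ` is
  nonzero, it has a basis containing a nonnegative vector of full support in `σ`. The corresponding
  pair makes all `x_i`, `i ∈ σ`, invertible, so that the pairs of this basis generate the congruence
  of `L_σ`.

Finally `L^σ` contains no nonzero nonnegative vector, so `I_{L^σ}` is homogeneous for a grading in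
which only the constants have degree `0`. By the graded form of Nakayama's lemma, if it is generated
by `m` elements, then `m` binomials suffice.
-/

namespace LatticeIdeal

open MvPolynomial

section Exponents

variable {ι : Type*}

/-- The inclusion `ℕ^ι → ℤ^ι` of exponent vectors. -/
def intVec : (ι →₀ ℕ) →+ (ι → ℤ) where
  toFun u := fun i => u i
  map_zero' := by ext; simp
  map_add' u v := by ext; simp

@[simp]
lemma intVec_apply (u : ι →₀ ℕ) (i : ι) : intVec u i = u i := rfl

lemma intVec_injective : Function.Injective (intVec : (ι →₀ ℕ) → ι → ℤ) := fun _ _ h =>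
  Finsupp.ext fun i => Nat.cast_injective (congrFun h i)

variable [Finite ι]

/-- The positive part `z⁺` of an integer vector, as an exponent vector. -/
noncomputable def posExp (z : ι → ℤ) : ι →₀ ℕ :=
  Finsupp.equivFunOnFinite.symm fun i => (z i).toNat

@[simp]
lemma posExp_apply (z : ι → ℤ) (i : ι) : posExp z i = (z i).toNat := rfl

lemma intVec_posExp {z : ι → ℤ} (hz : 0 ≤ z) : intVec (posExp z) = z :=
  funext fun i => Int.toNat_of_nonneg (hz i)

lemma posExp_of_nonpos {z : ι → ℤ} (hz : z ≤ 0) : posExp z = 0 :=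
  Finsupp.ext fun i => Int.toNat_of_nonpos (hz i)

lemma intVec_posExp_sub_neg (z : ι → ℤ) : intVec (posExp z) - intVec (posExp (-z)) = z :=
  funext fun i => Int.toNat_sub_toNat_neg (z i)

end Exponents

section Congruence

variable {ι κ : Type*}

/-- The congruence on exponent vectors defined by a lattice: `u ∼ v` if `u - v ∈ L`. -/
noncomputable def latticeCon (L : AddSubgroup (ι → ℤ)) : AddCon (ι →₀ ℕ) :=
  AddCon.ker ((QuotientAddGroup.mk' L).comp intVec)

lemma latticeCon_iff {L : AddSubgroup (ι → ℤ)} {u v : ι →₀ ℕ} :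
    latticeCon L u v ↔ intVec u - intVec v ∈ L :=
  QuotientAddGroup.eq_iff_sub_mem

lemma latticeCon_mono {L L' : AddSubgroup (ι → ℤ)} (h : L ≤ L') : latticeCon L ≤ latticeCon L' :=
  fun _ _ huv => latticeCon_iff.2 (h (latticeCon_iff.1 huv))

/-- The smallest congruence on exponent vectors that relates `u j` to `v j` for all `j`. -/
noncomputable def pairCon (u v : κ → ι →₀ ℕ) : AddCon (ι →₀ ℕ) :=
  addConGen fun a b => ∃ j, a = u j ∧ b = v j

lemma pairCon_le_iff {u v : κ → ι →₀ ℕ} {r : AddCon (ι →₀ ℕ)} :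
    pairCon u v ≤ r ↔ ∀ j, r (u j) (v j) := by
  rw [pairCon, AddCon.addConGen_le]
  constructor
  · exact fun h j => h (u j) (v j) ⟨j, rfl, rfl⟩
  · rintro h _ _ ⟨j, rfl, rfl⟩
    exact h j

lemma pairCon_apply (u v : κ → ι →₀ ℕ) (j : κ) : pairCon u v (u j) (v j) :=
  pairCon_le_iff.1 le_rfl j

/-- The congruence `r` on exponent vectors is generated by `m` pairs. This is what generation of a
binomial ideal by `m` binomials means for the exponents. -/
def IsGeneratedByPairs (r : AddCon (ι →₀ ℕ)) (m : ℕ) : Prop :=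
  ∃ u v : Fin m → ι →₀ ℕ, r = pairCon u v

lemma isGeneratedByPairs_pairCon [Finite κ] {m : ℕ} (hm : Nat.card κ ≤ m) (u v : κ → ι →₀ ℕ) :
    IsGeneratedByPairs (pairCon u v) m := by
  have := Fintype.ofFinite κ
  obtain ⟨e⟩ := Function.Embedding.nonempty_of_card_le (α := κ) (β := Fin m) <| by
    rwa [Fintype.card_fin, ← Nat.card_eq_fintype_card]
  refine ⟨Function.extend e u 0, Function.extend e v 0, eq_of_forall_ge_iff fun r => ?_⟩
  rw [pairCon_le_iff, pairCon_le_iff]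
  constructor
  · intro h j
    by_cases hj : ∃ a, e a = j
    · obtain ⟨a, rfl⟩ := hj
      simpa only [e.injective.extend_apply] using h a
    · rw [Function.extend_apply' _ _ _ hj, Function.extend_apply' _ _ _ hj]
      exact r.refl _
  · intro h a
    simpa only [e.injective.extend_apply] using h (e a)

lemma IsGeneratedByPairs.sup {r r' : AddCon (ι →₀ ℕ)} {m n : ℕ} (hr : IsGeneratedByPairs r m)
    (hr' : IsGeneratedByPairs r' n) : IsGeneratedByPairs (r ⊔ r') (m + n) := by
  obtain ⟨u, v, rfl⟩ := hr
  obtain ⟨u', v', rfl⟩ := hr'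
  have : pairCon u v ⊔ pairCon u' v' = pairCon (Sum.elim u u') (Sum.elim v v') := by
    refine eq_of_forall_ge_iff fun r => ?_
    rw [sup_le_iff, pairCon_le_iff, pairCon_le_iff, pairCon_le_iff, Sum.forall]
    rfl
  rw [this]
  exact isGeneratedByPairs_pairCon (by simp) _ _

/-- If `r` relates the two sides of each generator of a group of integer vectors, by exponents that
can be cancelled from `r`, then it contains the congruence of that group. -/
lemma rel_of_sub_mem_closure {r : AddCon (ι →₀ ℕ)} {M : AddSubmonoid (ι →₀ ℕ)}
    (hM : ∀ c ∈ M, ∀ u v, r (u + c) (v + c) → r u v) {Z : Set (ι → ℤ)}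
    (hZ : ∀ z ∈ Z, ∃ u ∈ M, ∃ v ∈ M, intVec u - intVec v = z ∧ r u v) {u v : ι →₀ ℕ}
    (h : intVec u - intVec v ∈ AddSubgroup.closure Z) : r u v := by
  have rel_of_mem : ∀ z ∈ AddSubgroup.closure Z,
      ∃ u ∈ M, ∃ v ∈ M, intVec u - intVec v = z ∧ r u v := by
    intro z hz
    induction hz using AddSubgroup.closure_induction with
    | mem z hz => exact hZ z hz
    | zero => exact ⟨0, M.zero_mem, 0, M.zero_mem, by simp, r.refl 0⟩
    | add y z _ _ hy hz =>
      obtain ⟨a, ha, b, hb, rfl, hab⟩ := hy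
      obtain ⟨c, hc, d, hd, rfl, hcd⟩ := hz
      exact ⟨a + c, M.add_mem ha hc, b + d, M.add_mem hb hd,
        by rw [map_add, map_add, add_sub_add_comm], r.add hab hcd⟩
    | neg z _ hz =>
      obtain ⟨a, ha, b, hb, rfl, hab⟩ := hz
      exact ⟨b, hb, a, ha, (neg_sub _ _).symm, r.symm hab⟩
  obtain ⟨a, -, b, hb, hz, hab⟩ := rel_of_mem _ h
  have hsum : u + b = a + v := intVec_injective <| by
    rw [map_add, map_add, sub_eq_sub_iff_add_eq_add.1 hz.symm]
  refine hM b hb u v ?_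
  rw [hsum, add_comm v]
  exact r.add hab (r.refl v)

end Congruence

section BinomialIdeals

variable {ι κ k : Type*} [CommRing k]

variable (k) in
/-- The pure difference binomial `x^u - x^v`. -/
noncomputable def binomial (u v : ι →₀ ℕ) : MvPolynomial ι k :=
  monomial u 1 - monomial v 1

lemma binomial_add_right (u v c : ι →₀ ℕ) :
    binomial k (u + c) (v + c) = binomial k u v * monomial c 1 := by
  simp only [binomial, sub_mul, monomial_mul, mul_one]

lemma binomial_add_binomial (u v w : ι →₀ ℕ) :
    binomial k u v + binomial k v w = binomial k u w :=
  sub_add_sub_cancel _ _ _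

/-- The congruence on exponent vectors defined by an ideal: `u ∼ v` if `x^u - x^v ∈ I`. -/
def idealCon (I : Ideal (MvPolynomial ι k)) : AddCon (ι →₀ ℕ) where
  r u v := binomial k u v ∈ I
  iseqv :=
    { refl u := by rw [binomial, sub_self]; exact I.zero_mem
      symm {u v} h := by rw [binomial, ← neg_sub]; exact I.neg_mem h
      trans {u v w} h h' := by rw [← binomial_add_binomial u v w]; exact I.add_mem h h' }
  add' {a b c d} h h' := by
    rw [← binomial_add_binomial (a + c) (b + c), add_comm b c, add_comm b d, binomial_add_right,
      add_comm c b, binomial_add_right]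
    exact I.add_mem (I.mul_mem_right _ h) (I.mul_mem_right _ h')

lemma idealCon_iff {I : Ideal (MvPolynomial ι k)} {u v : ι →₀ ℕ} :
    idealCon I u v ↔ binomial k u v ∈ I := Iff.rfl

variable (k) in
/-- The binomial ideal `⟨x^u - x^v : u ∼ v⟩` defined by a congruence on exponent vectors. -/
noncomputable def conIdeal (r : AddCon (ι →₀ ℕ)) : Ideal (MvPolynomial ι k) :=
  Ideal.span {f | ∃ u v, r u v ∧ f = binomial k u v}

lemma conIdeal_le_iff {r : AddCon (ι →₀ ℕ)} {I : Ideal (MvPolynomial ι k)} :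
    conIdeal k r ≤ I ↔ r ≤ idealCon I := by
  rw [conIdeal, Ideal.span_le]
  constructor
  · exact fun h u v huv => h ⟨u, v, huv, rfl⟩
  · rintro h _ ⟨u, v, huv, rfl⟩
    exact h huv

/-- The monoid algebra of `(ι →₀ ℕ) ⧸ r` separates unrelated monomials and kills the ideal. -/
lemma idealCon_conIdeal [Nontrivial k] (r : AddCon (ι →₀ ℕ)) : idealCon (conIdeal k r) = r := by
  let φ : MvPolynomial ι k →+* AddMonoidAlgebra k r.Quotient :=
    AddMonoidAlgebra.mapDomainRingHom k r.mk'
  have map_monomial (u : ι →₀ ℕ) :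
      φ (monomial u 1) = AddMonoidAlgebra.single (u : r.Quotient) 1 :=
    AddMonoidAlgebra.mapDomain_single
  have mem_ker {u v} : binomial k u v ∈ RingHom.ker φ ↔ r u v := by
    rw [RingHom.mem_ker, binomial, map_sub, map_monomial, map_monomial, sub_eq_zero, ← AddCon.eq]
    exact (AddMonoidAlgebra.single_left_injective one_ne_zero).eq_iff
  have conIdeal_le_ker : conIdeal k r ≤ RingHom.ker φ :=
    conIdeal_le_iff.2 fun _ _ h => mem_ker.2 h
  exact le_antisymm (fun _ _ h => mem_ker.1 (conIdeal_le_ker h)) (conIdeal_le_iff.1 le_rfl)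

lemma conIdeal_injective [Nontrivial k] :
    Function.Injective (conIdeal k : AddCon (ι →₀ ℕ) → Ideal (MvPolynomial ι k)) :=
  Function.LeftInverse.injective idealCon_conIdeal

lemma latticeIdeal_eq_conIdeal (L : AddSubgroup (ι → ℤ)) :
    latticeIdeal k L = conIdeal k (latticeCon L) := by
  simp only [conIdeal, latticeCon_iff]
  rfl

lemma binomial_mem_latticeIdeal_iff [Nontrivial k] {L : AddSubgroup (ι → ℤ)} {u v : ι →₀ ℕ} :
    binomial k u v ∈ latticeIdeal k L ↔ intVec u - intVec v ∈ L := by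
  rw [← idealCon_iff, latticeIdeal_eq_conIdeal, idealCon_conIdeal, latticeCon_iff]

lemma span_range_binomial (u v : κ → ι →₀ ℕ) :
    Ideal.span (Set.range fun j => binomial k (u j) (v j)) = conIdeal k (pairCon u v) := by
  refine eq_of_forall_ge_iff fun I => ?_
  rw [conIdeal_le_iff, pairCon_le_iff, Ideal.span_le, Set.range_subset_iff]
  rfl

end BinomialIdeals

section Height

lemma height_comap_C_le {R : Type*} [CommRing R] [IsNoetherianRing R] (Q : Ideal (Polynomial R))
    [Q.IsPrime] : (Q.comap Polynomial.C).height ≤ Q.height := by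
  have : Q.LiesOver (Q.comap Polynomial.C) := ⟨rfl⟩
  rw [Ideal.height_eq_height_add_of_liesOver_of_hasGoingDown (Q.comap Polynomial.C) Q]
  exact le_self_add

lemma height_comap_C_add_one_le {R : Type*} [CommRing R] [IsNoetherianRing R]
    (Q : Ideal (Polynomial R)) [Q.IsPrime]
    (hQ : (Q.comap Polynomial.C).map Polynomial.C ≠ Q) :
    (Q.comap Polynomial.C).height + 1 ≤ Q.height := by
  set p := Q.comap Polynomial.C
  have hle : p.map Polynomial.C ≤ Q := Ideal.map_comap_le
  have hprime : (p.map Polynomial.C).IsPrime := Ideal.isPrime_map_C_of_isPrime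
  have hcomap : (p.map Polynomial.C).comap Polynomial.C = p :=
    le_antisymm (Ideal.comap_mono hle) Ideal.le_comap_map
  calc p.height + 1 ≤ (p.map Polynomial.C).height + 1 := by
        gcongr
        simpa only [hcomap] using height_comap_C_le (p.map Polynomial.C)
    _ ≤ Q.height := Ideal.height_add_one_le_of_lt_of_isPrime (lt_of_le_of_ne hle hQ)

lemma optionEquivLeft_rename_optionMap {ι κ R : Type*} [CommRing R] (j : κ → ι)
    (f : MvPolynomial (Option κ) R) :
    optionEquivLeft R ι (rename (Option.map j) f) =
      (optionEquivLeft R κ f).map (rename j : MvPolynomial κ R →ₐ[R] _) := by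
  induction f using MvPolynomial.induction_on with
  | C a => simp
  | add p q hp hq => simp [hp, hq]
  | mul_X p i hp => cases i <;> simp [hp]

lemma optionEquivLeft_rename_some {ι R : Type*} [CommRing R] (f : MvPolynomial ι R) :
    optionEquivLeft R ι (rename some f) = Polynomial.C f := by
  induction f using MvPolynomial.induction_on with
  | C a => simp
  | add p q hp hq => simp [hp, hq]
  | mul_X p i hp => simp [hp]

lemma height_comap_rename_some {ι R : Type*} [Finite ι] [CommRing R] [IsNoetherianRing R]
    (P : Ideal (MvPolynomial (Option ι) R)) [P.IsPrime] :
    (P.comap (rename some)).height + 1 ≤ P.height ∨ (P.comap (rename some)).height ≤ P.height ∧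
      ∀ f ∈ P, ∀ i, (optionEquivLeft R ι f).coeff i ∈ P.comap (rename some) := by
  let E : MvPolynomial (Option ι) R ≃+* Polynomial (MvPolynomial ι R) :=
    (optionEquivLeft R ι).toRingEquiv
  let Q := P.comap E.symm
  have mem_Q (f) : E f ∈ Q ↔ f ∈ P := by simp [Q]
  have height_Q : Q.height = P.height := E.symm.height_comap P
  have comap_Q : Q.comap Polynomial.C = P.comap (rename some) := by
    ext f
    rw [Ideal.mem_comap, Ideal.mem_comap, ← optionEquivLeft_rename_some]
    exact mem_Q _
  rw [← comap_Q, ← height_Q]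
  by_cases hQ : (Q.comap Polynomial.C).map Polynomial.C = Q
  · refine .inr ⟨height_comap_C_le Q, fun f hf => Ideal.mem_map_C_iff.1 ?_⟩
    rw [hQ]
    exact (mem_Q f).2 hf
  · exact .inl (height_comap_C_add_one_le Q hQ)

lemma comap_rename_optionMap_eq_bot {ι κ R : Type*} [CommRing R]
    {P : Ideal (MvPolynomial (Option ι) R)} {p : Ideal (MvPolynomial ι R)} {j : κ → ι}
    (hcoeff : ∀ f ∈ P, ∀ i, (optionEquivLeft R ι f).coeff i ∈ p) (hj : p.comap (rename j) = ⊥) :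
    P.comap (rename (Option.map j)) = ⊥ := by
  rw [eq_bot_iff]
  intro f hf
  refine (optionEquivLeft R κ).injective (Polynomial.ext fun i => ?_)
  have coeff_mem : (optionEquivLeft R κ f).coeff i ∈ p.comap (rename j) := by
    have := hcoeff (rename (Option.map j) f) hf i
    rwa [optionEquivLeft_rename_optionMap, Polynomial.coeff_map] at this
  rw [hj, Ideal.mem_bot] at coeff_mem
  rw [coeff_mem, map_zero, Polynomial.coeff_zero]

universe u

/-- Adjoining the variables one at a time, the height grows by one unless the new variable stays
independent modulo `P`. -/
lemma exists_independent_variables {ι : Type u} [Finite ι] {k : Type*} [Field k] :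
    ∀ (P : Ideal (MvPolynomial ι k)) [P.IsPrime], ∃ (κ : Type u) (j : κ ↪ ι),
      (Nat.card ι : ℕ∞) ≤ Nat.card κ + P.height ∧ P.comap (rename j) = ⊥ := by
  induction ι using Finite.induction_empty_option with
  | @of_equiv α β e ih =>
    intro P _
    let E : MvPolynomial α k ≃+* MvPolynomial β k := (renameEquiv k e).toRingEquiv
    obtain ⟨κ, j, hcard, hj⟩ := ih (P.comap E)
    refine ⟨κ, j.trans e.toEmbedding, ?_, ?_⟩
    · rwa [← Nat.card_congr e, ← E.height_comap P]
    · rw [← hj]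
      ext f
      exact iff_of_eq (congrArg (· ∈ P) (rename_rename j e f).symm)
  | h_empty =>
    intro P hP
    refine ⟨PEmpty, Function.Embedding.refl _, by simp, ?_⟩
    rw [eq_bot_iff]
    intro f hf
    obtain ⟨c, rfl⟩ := C_surjective PEmpty f
    have mem_comap_C : c ∈ P.comap C := by simpa using hf
    rw [Ideal.eq_bot_of_prime (P.comap C), Ideal.mem_bot] at mem_comap_C
    rw [mem_comap_C, map_zero]
    exact zero_mem _
  | @h_option α _ ih =>
    intro P _
    obtain ⟨κ, j, hcard, hj⟩ := ih (P.comap (rename some))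
    have : Finite κ := Finite.of_injective j j.injective
    rcases height_comap_rename_some P with hP | ⟨hP, hcoeff⟩
    · refine ⟨κ, j.trans Function.Embedding.some, ?_, ?_⟩
      · rw [Finite.card_option, Nat.cast_add_one]
        calc (Nat.card α + 1 : ℕ∞)
          _ ≤ Nat.card κ + ((P.comap (rename some)).height + 1) := by rw [← add_assoc]; gcongr
          _ ≤ Nat.card κ + P.height := by gcongr
      · rw [← hj]
        ext f
        exact iff_of_eq (congrArg (· ∈ P) (rename_rename j some f).symm)
    · refine ⟨Option κ, j.optionMap, ?_, ?_⟩
      · rw [Finite.card_option, Finite.card_option, Nat.cast_add_one, Nat.cast_add_one,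
          add_right_comm]
        gcongr
        exact hcard.trans (by gcongr)
      · exact comap_rename_optionMap_eq_bot hcoeff hj

variable {ι k : Type*} [Finite ι]

instance (L : AddSubgroup (ι → ℤ)) : Module.Finite ℤ L :=
  inferInstanceAs (Module.Finite ℤ (AddSubgroup.toIntSubmodule L))

instance (L : AddSubgroup (ι → ℤ)) : Module.Free ℤ L :=
  inferInstanceAs (Module.Free ℤ (AddSubgroup.toIntSubmodule L))

lemma closure_range_basis {A κ : Type*} [AddCommGroup A] {L : AddSubgroup A}
    (b : Module.Basis κ ℤ L) : AddSubgroup.closure (Set.range fun j => (b j : A)) = L := by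
  have closure_eq_top : AddSubgroup.closure (Set.range b) = ⊤ :=
    AddSubgroup.toIntSubmodule.injective <| by
      rw [AddSubgroup.toIntSubmodule_closure]
      exact b.span_eq
  have := AddMonoidHom.map_closure L.subtype (Set.range b)
  rwa [closure_eq_top, ← AddMonoidHom.range_eq_map, AddSubgroup.range_subtype, ← Set.range_comp,
    eq_comm] at this

lemma finrank_le_card_of_forall_eq_zero (L : AddSubgroup (ι → ℤ)) (s : Set ι)
    (hL : ∀ z ∈ L, (∀ i ∉ s, z i = 0) → z = 0) :
    Module.finrank ℤ L ≤ Nat.card {i // i ∉ s} := by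
  classical
  have := Fintype.ofFinite {i // i ∉ s}
  let ρ : L →ₗ[ℤ] ({i // i ∉ s} → ℤ) := ((forget s).comp L.subtype).toIntLinearMap
  have ρ_injective : Function.Injective ρ := (injective_iff_map_eq_zero ρ).2 fun z hz =>
    Subtype.ext (hL z z.2 fun i hi => congrFun hz ⟨i, hi⟩)
  have := LinearMap.finrank_le_finrank_of_injective ρ_injective
  rwa [Module.finrank_fintype_fun_eq_card, ← Nat.card_eq_fintype_card] at this

/-- A vector of `L` supported on variables that are independent modulo `P` gives a binomial in `P`
in these variables, which must be zero. -/
lemma eq_zero_of_comap_rename_eq_bot [CommRing k] [Nontrivial k] {κ : Type*}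
    {L : AddSubgroup (ι → ℤ)} {P : Ideal (MvPolynomial ι k)} (hLP : latticeIdeal k L ≤ P)
    (j : κ ↪ ι) (hj : P.comap (rename j) = ⊥) {z : ι → ℤ} (hz : z ∈ L)
    (hzj : ∀ i ∉ Set.range j, z i = 0) :
    z = 0 := by
  have exists_mapDomain (y : ι → ℤ) (hy : ∀ i ∉ Set.range j, y i = 0) :
      ∃ u, Finsupp.mapDomain j u = posExp y := by
    refine ⟨_, Finsupp.mapDomain_comapDomain j j.injective (posExp y) fun i hi => ?_⟩
    by_contra hij
    simp [hy i hij] at hi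
  obtain ⟨u, hu⟩ := exists_mapDomain z hzj
  obtain ⟨v, hv⟩ := exists_mapDomain (-z) fun i hi => by rw [Pi.neg_apply, hzj i hi, neg_zero]
  have binomial_mem : binomial k u v ∈ P.comap (rename j) := by
    rw [Ideal.mem_comap, binomial, map_sub, rename_monomial, rename_monomial, hu, hv]
    refine hLP (binomial_mem_latticeIdeal_iff.2 ?_)
    rwa [intVec_posExp_sub_neg]
  rw [hj, Ideal.mem_bot, binomial, sub_eq_zero] at binomial_mem
  have huv : u = v := monomial_left_injective one_ne_zero binomial_mem
  rw [← intVec_posExp_sub_neg z, ← hu, ← hv, huv, sub_self]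

lemma finrank_le_height_latticeIdeal [Field k] (L : AddSubgroup (ι → ℤ)) :
    (Module.finrank ℤ L : ℕ∞) ≤ (latticeIdeal k L).height := by
  rw [Ideal.height_eq_inf_minimalPrimes]
  refine le_iInf₂ fun P hP => ?_
  have := hP.isPrime
  obtain ⟨κ, j, hcard, hj⟩ := exists_independent_variables P
  have hL := finrank_le_card_of_forall_eq_zero L (Set.range j) fun z hz hzj =>
    eq_zero_of_comap_rename_eq_bot hP.le j hj hz hzj
  have hι : Nat.card {i // i ∉ Set.range j} + Nat.card κ = Nat.card ι := by
    rw [← Nat.card_range_of_injective j.injective, add_comm]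
    exact Set.ncard_add_ncard_compl _
  have : (Module.finrank ℤ L : ℕ∞) + Nat.card κ ≤ P.height + Nat.card κ := by
    rw [add_comm P.height]
    exact le_trans (by exact_mod_cast hι ▸ Nat.add_le_add_right hL _) hcard
  exact (ENat.add_le_add_iff_right (ENat.natCast_ne_top _)).1 this

/-- Passing to a prime below the ideal of the point `(1, …, 1)`, no variable lies in it. -/
lemma height_latticeIdeal_le_finrank [CommRing k] [IsDomain k] [IsNoetherianRing k]
    (L : AddSubgroup (ι → ℤ)) :
    (latticeIdeal k L).height ≤ (Module.finrank ℤ L : ℕ∞) := by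
  let b := Module.finBasis ℤ L
  let B : Fin (Module.finrank ℤ L) → MvPolynomial ι k := fun j =>
    binomial k (posExp (b j)) (posExp (-b j))
  let m : Ideal (MvPolynomial ι k) := RingHom.ker (eval fun _ => (1 : k))
  have hm : m.IsPrime := RingHom.ker_isPrime _
  have hBm : Ideal.span (Set.range B) ≤ m := by
    rw [Ideal.span_le]
    rintro _ ⟨j, rfl⟩
    simp [m, B, binomial, eval_monomial]
  obtain ⟨P, hP, hPm⟩ := Ideal.exists_minimalPrimes_le hBm
  have hPprime := hP.isPrime
  have idealCon_cancel (c u v : ι →₀ ℕ) (h : idealCon P (u + c) (v + c)) : idealCon P u v := by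
    rw [idealCon_iff, binomial_add_right] at h
    refine (hPprime.mem_or_mem h).resolve_right fun hc => ?_
    simpa [m, eval_monomial] using hPm hc
  have hLP : latticeIdeal k L ≤ P := by
    rw [latticeIdeal_eq_conIdeal, conIdeal_le_iff]
    intro u v huv
    rw [latticeCon_iff, ← closure_range_basis b] at huv
    refine rel_of_sub_mem_closure (M := ⊤) (fun c _ => idealCon_cancel c) ?_ huv
    rintro _ ⟨j, rfl⟩
    exact ⟨posExp (b j), trivial, posExp (-b j), trivial, intVec_posExp_sub_neg _,
      hP.le (Ideal.subset_span ⟨j, rfl⟩)⟩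
  calc (latticeIdeal k L).height ≤ P.height := Ideal.height_mono hLP
    _ ≤ (Set.range B).ncard :=
      Ideal.height_le_card_of_mem_minimalPrimes_span (Set.finite_range B) hP
    _ ≤ Module.finrank ℤ L := by
      exact_mod_cast (Finite.card_range_le B).trans_eq (Nat.card_fin _)

theorem height_latticeIdeal [Field k] (L : AddSubgroup (ι → ℤ)) :
    (latticeIdeal k L).height = (Module.finrank ℤ L : ℕ∞) :=
  le_antisymm (height_latticeIdeal_le_finrank L) (finrank_le_height_latticeIdeal L)

end Height

section Selection

variable {R M : Type*} [CommRing R] [AddCommGroup M] [Module R M] (𝔪 : Ideal R) [𝔪.IsMaximal]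

lemma exists_fin_span_sup_smul_top_eq_top {m : ℕ} {f : Fin m → M}
    (hf : Submodule.span R (Set.range f) = ⊤) {B : Set M} (hB : Submodule.span R B = ⊤) :
    ∃ n ≤ m, ∃ g : Fin n → M, (∀ j, g j ∈ B) ∧
      Submodule.span R (Set.range g) ⊔ 𝔪 • ⊤ = ⊤ := by
  let := Ideal.Quotient.field 𝔪
  let π := (𝔪 • ⊤ : Submodule R M).mkQ
  have span_eq_map (s : Set M) : (Submodule.span (R ⧸ 𝔪) (π '' s)).restrictScalars R =
      (Submodule.span R s).map π := by
    rw [Submodule.restrictScalars_span _ _ Ideal.Quotient.mk_surjective, Submodule.map_span]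
  have span_eq_top {s : Set M} (hs : Submodule.span R s = ⊤) :
      Submodule.span (R ⧸ 𝔪) (π '' s) = ⊤ := by
    rw [← Submodule.restrictScalars_eq_top_iff R, span_eq_map, hs, Submodule.map_top,
      Submodule.range_mkQ]
  have hπf := span_eq_top hf
  rw [← Set.range_comp] at hπf
  have : Module.Finite (R ⧸ 𝔪) (M ⧸ (𝔪 • ⊤ : Submodule R M)) :=
    ⟨Submodule.fg_def.2 ⟨_, Set.finite_range _, hπf⟩⟩
  obtain ⟨b, hbB, hb, -⟩ := Submodule.exists_fun_fin_finrank_span_eq (R ⧸ 𝔪) (π '' B)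
  choose g hgB hgb using hbB
  refine ⟨_, ?_, g, hgB, ?_⟩
  · calc _ ≤ Module.finrank (R ⧸ 𝔪) (M ⧸ (𝔪 • ⊤ : Submodule R M)) := Submodule.finrank_le _
      _ ≤ m := (finrank_le_of_span_eq_top hπf).trans_eq (Fintype.card_fin m)
  · have hπg : b = π ∘ g := funext fun j => (hgb j).symm
    rw [sup_comm, ← Submodule.map_mkQ_eq_top, ← span_eq_map, ← Set.range_comp,
      Submodule.restrictScalars_eq_top_iff, ← hπg, hb, span_eq_top hB]

lemma exists_fin_span_sup_smul {m : ℕ} {N : Submodule R M} {f : Fin m → M}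
    (hf : N = Submodule.span R (Set.range f)) {B : Set M} (hB : N = Submodule.span R B) :
    ∃ n ≤ m, ∃ g : Fin n → M, (∀ j, g j ∈ B) ∧ N ≤ Submodule.span R (Set.range g) ⊔ 𝔪 • N := by
  have hfN (j) : f j ∈ N := hf ▸ Submodule.subset_span ⟨j, rfl⟩
  have hf' : Submodule.span R (Set.range fun j => (⟨f j, hfN j⟩ : N)) = ⊤ := by
    refine Submodule.map_injective_of_injective N.subtype_injective ?_
    rw [Submodule.map_span, ← Set.range_comp, Submodule.map_subtype_top]
    exact hf.symm
  have hB' : Submodule.span R ((↑) ⁻¹' B : Set N) = ⊤ := by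
    subst hB
    exact Submodule.span_span_coe_preimage
  obtain ⟨n, hn, g, hg, htop⟩ := exists_fin_span_sup_smul_top_eq_top 𝔪 hf' hB'
  refine ⟨n, hn, fun j => g j, hg, ?_⟩
  have := congrArg (Submodule.map N.subtype) htop
  rw [Submodule.map_sup, Submodule.map_span, Submodule.map_smul'', Submodule.map_subtype_top,
    ← Set.range_comp] at this
  exact this.ge

end Selection

section Graded

variable {ι k A : Type*} [CommRing k]

lemma weightedHomogeneousComponent_zero_of_weight_ne_zero [AddCommMonoid A] {w : ι → A}
    (hw : ∀ u : ι →₀ ℕ, Finsupp.weight w u = 0 → u = 0) (f : MvPolynomial ι k) :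
    weightedHomogeneousComponent w 0 f = C (constantCoeff f) := by
  classical
  ext u
  rw [coeff_weightedHomogeneousComponent, coeff_C]
  by_cases hu : u = 0
  · simp [hu, constantCoeff_eq]
  · rw [if_neg (mt (hw u) hu), if_neg (Ne.symm hu)]

attribute [local instance] MvPolynomial.weightedGradedAlgebra

/-- Comparing components of degree `a`: only the constant term of `r` contributes. -/
lemma mem_of_mul_mem_of_isWeightedHomogeneous [AddCancelCommMonoid A] [DecidableEq A] {w : ι → A}
    (hw : ∀ u : ι →₀ ℕ, Finsupp.weight w u = 0 → u = 0) {J : Ideal (MvPolynomial ι k)}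
    (hJ : J.IsHomogeneous (weightedHomogeneousSubmodule k w)) {r b : MvPolynomial ι k} {a : A}
    (hr : constantCoeff r = 1) (hb : IsWeightedHomogeneous w b a) (h : r * b ∈ J) : b ∈ J := by
  have := hJ (0 + a) h
  rw [DirectSum.coe_decompose_mul_add_of_right_mem _ hb] at this
  have decompose_zero : (DirectSum.decompose (weightedHomogeneousSubmodule k w) r 0 : _) =
      weightedHomogeneousComponent w 0 r := weightedDecomposition.decompose'_apply k w r 0
  rwa [decompose_zero, weightedHomogeneousComponent_zero_of_weight_ne_zero hw, hr, C_1, one_mul]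
    at this

/-- The grading of `k[x]` by `ℤ^ι / L`, given by the classes of the unit vectors. -/
noncomputable def latticeWeight (L : AddSubgroup (ι → ℤ)) (i : ι) : (ι → ℤ) ⧸ L :=
  QuotientAddGroup.mk (intVec (Finsupp.single i 1))

lemma weight_latticeWeight (L : AddSubgroup (ι → ℤ)) (u : ι →₀ ℕ) :
    Finsupp.weight (latticeWeight L) u = QuotientAddGroup.mk (intVec u) := by
  suffices (Finsupp.weight (latticeWeight L) : (ι →₀ ℕ) →+ _) =
      (QuotientAddGroup.mk' L).comp intVec from DFunLike.congr_fun this u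
  ext i
  simp [latticeWeight, Finsupp.weight_single]

lemma eq_zero_of_intVec_mem {L : AddSubgroup (ι → ℤ)} (hL : posSupport L = ∅) {u : ι →₀ ℕ}
    (hu : intVec u ∈ L) : u = 0 := by
  by_contra hne
  obtain ⟨i, hi⟩ := Finsupp.ne_iff.1 hne
  have : i ∈ posSupport L :=
    ⟨intVec u, hu, fun i => Int.natCast_nonneg _, Int.natCast_ne_zero.2 hi⟩
  simp [hL] at this

lemma weight_latticeWeight_eq_zero {L : AddSubgroup (ι → ℤ)}
    (hL : posSupport L = ∅) {u : ι →₀ ℕ} (hu : Finsupp.weight (latticeWeight L) u = 0) : u = 0 := by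
  rw [weight_latticeWeight, QuotientAddGroup.eq_zero_iff] at hu
  exact eq_zero_of_intVec_mem hL hu

lemma isWeightedHomogeneous_binomial {L : AddSubgroup (ι → ℤ)} {u v : ι →₀ ℕ}
    (huv : latticeCon L u v) : IsWeightedHomogeneous (latticeWeight L) (binomial k u v)
      (Finsupp.weight (latticeWeight L) u) := by
  have : Finsupp.weight (latticeWeight L) v = Finsupp.weight (latticeWeight L) u := by
    rw [weight_latticeWeight, weight_latticeWeight]
    exact ((AddCon.ker_rel _).1 huv).symm
  exact Submodule.sub_mem (weightedHomogeneousSubmodule k _ _)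
    (isWeightedHomogeneous_monomial _ u 1 rfl) (isWeightedHomogeneous_monomial _ v 1 this)

/-- Nakayama's lemma for the ideal of the origin, made global by the grading. -/
lemma isGeneratedByPairs_latticeCon_of_posSupport_eq_empty [Finite ι] {k : Type*} [Field k]
    {L : AddSubgroup (ι → ℤ)} (hL : posSupport L = ∅) {m : ℕ} {f : Fin m → MvPolynomial ι k}
    (hf : latticeIdeal k L = Ideal.span (Set.range f)) :
    IsGeneratedByPairs (latticeCon L) m := by
  classical
  let 𝔪 : Ideal (MvPolynomial ι k) := RingHom.ker constantCoeff
  have : 𝔪.IsMaximal := RingHom.ker_isMaximal_of_surjective _ fun c => ⟨C c, constantCoeff_C _ c⟩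
  obtain ⟨n, hn, g, hg, hle⟩ := exists_fin_span_sup_smul 𝔪 hf (latticeIdeal_eq_conIdeal L)
  choose u v huv hguv using hg
  obtain rfl : g = fun j => binomial k (u j) (v j) := funext hguv
  suffices latticeCon L ≤ pairCon u v by
    rw [le_antisymm this (pairCon_le_iff.2 huv)]
    exact isGeneratedByPairs_pairCon (by rwa [Nat.card_fin]) u v
  set J : Ideal (MvPolynomial ι k) := Ideal.span (Set.range fun j => binomial k (u j) (v j)) with hJ
  have J_isHomogeneous : J.IsHomogeneous (weightedHomogeneousSubmodule k (latticeWeight L)) := by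
    refine Ideal.homogeneous_span _ _ ?_
    rintro _ ⟨j, rfl⟩
    exact ⟨_, isWeightedHomogeneous_binomial (huv j)⟩
  obtain ⟨r, hr, hrJ⟩ := Submodule.exists_sub_one_mem_and_smul_le_of_fg_of_le_sup
    (IsNoetherian.noetherian (latticeIdeal k L)) le_rfl hle
  have constantCoeff_r : constantCoeff r = 1 := by
    rwa [RingHom.mem_ker, map_sub, map_one, sub_eq_zero] at hr
  have le_idealCon : latticeCon L ≤ idealCon J := fun x y hxy =>
    mem_of_mul_mem_of_isWeightedHomogeneous (fun _ => weight_latticeWeight_eq_zero hL)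
      J_isHomogeneous constantCoeff_r (isWeightedHomogeneous_binomial hxy) <|
        hrJ (Submodule.smul_mem_pointwise_smul _ r _
          (binomial_mem_latticeIdeal_iff.2 (latticeCon_iff.1 hxy)))
  rwa [hJ, span_range_binomial, idealCon_conIdeal] at le_idealCon

end Graded

section Lattices

lemma exists_basis_eq_smul {R M : Type*} [CommRing R] [IsDomain R] [IsPrincipalIdealRing R]
    [AddCommGroup M] [Module R M] [Module.Free R M] [Module.Finite R M] {w : M} (hw : w ≠ 0) :
    ∃ (b : Module.Basis (Fin (Module.finrank R M)) R M) (j : _) (c : R), w = c • b j := by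
  obtain ⟨m, snf⟩ := Submodule.smithNormalForm (Module.finBasis R M) (R ∙ w)
  obtain rfl : m = 1 := by
    have := (LinearEquiv.toSpanNonzeroSingleton R M w hw).finrank_eq
    rwa [Module.finrank_self, Module.finrank_eq_card_basis snf.bN, Fintype.card_fin,
      eq_comm] at this
  refine ⟨snf.bM, snf.f 0, snf.bN.repr ⟨w, Submodule.mem_span_singleton_self w⟩ 0 * snf.a 0, ?_⟩
  have := congrArg Subtype.val (snf.bN.sum_repr ⟨w, Submodule.mem_span_singleton_self w⟩)
  rw [Fin.sum_univ_one, Submodule.coe_smul, snf.snf, smul_smul] at this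
  exact this.symm

lemma exists_basis_eq_pos_smul {M : Type*} [AddCommGroup M] [Module.Free ℤ M] [Module.Finite ℤ M]
    {w : M} (hw : w ≠ 0) :
    ∃ (b : Module.Basis (Fin (Module.finrank ℤ M)) ℤ M) (j : _) (c : ℤ), 0 < c ∧ w = c • b j := by
  obtain ⟨b, j, c, rfl⟩ := exists_basis_eq_smul (R := ℤ) hw
  rcases lt_trichotomy c 0 with hc | rfl | hc
  · exact ⟨b.map (LinearEquiv.neg ℤ), j, -c, neg_pos.2 hc, by simp⟩
  · exact absurd (zero_smul ℤ _) hw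
  · exact ⟨b, j, c, hc, rfl⟩

lemma finrank_map_add_finrank_inf_ker {A B : Type*} [AddCommGroup A] [AddCommGroup B]
    (f : A →+ B) (L : AddSubgroup A) [Module.Finite ℤ L] :
    Module.finrank ℤ (L.map f) + Module.finrank ℤ ↥(L ⊓ f.ker) = Module.finrank ℤ L := by
  let g : L →ₗ[ℤ] L.map f := (f.addSubgroupMap L).toIntLinearMap
  have hg : Function.Surjective g := f.addSubgroupMap_surjective L
  let e : LinearMap.ker g ≃+ ↥(L ⊓ f.ker) :=
    { toFun x := ⟨x.1.1, x.1.2, congrArg Subtype.val x.2⟩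
      invFun x := ⟨⟨x.1, x.2.1⟩, Subtype.ext x.2.2⟩
      map_add' _ _ := rfl }
  have := (LinearMap.ker g).finrank_quotient_add_finrank
  rwa [(g.quotKerEquivOfSurjective hg).finrank_eq, e.toIntLinearEquiv.finrank_eq] at this

lemma finrank_le_card_of_le_closure {A κ : Type*} [AddCommGroup A] [Finite κ] {K : AddSubgroup A}
    {z : κ → A} (h : K ≤ AddSubgroup.closure (Set.range z)) :
    Module.finrank ℤ K ≤ Nat.card κ := by
  have := Fintype.ofFinite κ
  have h' : AddSubgroup.toIntSubmodule K ≤ Submodule.span ℤ (Set.range z) := by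
    rw [← AddSubgroup.toIntSubmodule_closure]
    exact AddSubgroup.toIntSubmodule.monotone h
  have : Module.Finite ℤ (Submodule.span ℤ (Set.range z)) :=
    Module.Finite.span_of_finite ℤ (Set.finite_range z)
  rw [Nat.card_eq_fintype_card]
  exact (Submodule.finrank_mono h').trans (finrank_range_le_card z)

variable {ι : Type*}

lemma exists_nonneg_add_nsmul [Finite ι] {s : Set ι} {u w : ι → ℤ} (hw : 0 ≤ w)
    (hws : ∀ i ∈ s, 0 < w i) (hu : ∀ i ∉ s, 0 ≤ u i) : ∃ N : ℕ, 0 ≤ u + N • w := by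
  obtain ⟨N, hN⟩ := Finite.exists_le fun i => (-u i).toNat
  refine ⟨N, fun i => ?_⟩
  rw [Pi.zero_apply, Pi.add_apply, Pi.smul_apply, nsmul_eq_mul]
  by_cases hi : i ∈ s
  · have : -u i ≤ N := Int.toNat_le.1 (hN i)
    have : (N : ℤ) * 1 ≤ N * w i := by gcongr; exact hws i hi
    linarith
  · exact add_nonneg (hu i hi) (mul_nonneg (Int.natCast_nonneg N) (hw i))

lemma eq_zero_of_notMem_posSupport {L : AddSubgroup (ι → ℤ)} {w : ι → ℤ} (hw : w ∈ L)
    (hw0 : 0 ≤ w) {i : ι} (hi : i ∉ posSupport L) : w i = 0 :=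
  not_not.1 fun h => hi ⟨w, hw, hw0, h⟩

lemma exists_mem_forall_mem_posSupport_pos [Finite ι] (L : AddSubgroup (ι → ℤ)) :
    ∃ w ∈ L, 0 ≤ w ∧ ∀ i ∈ posSupport L, 0 < w i := by
  have := Fintype.ofFinite (posSupport L)
  choose f hfL hf0 hf using fun i : posSupport L => i.2
  refine ⟨∑ i, f i, L.sum_mem fun i _ => hfL i, Finset.sum_nonneg fun i _ => hf0 i, fun i hi => ?_⟩
  rw [Finset.sum_apply]
  exact Finset.sum_pos' (fun j _ => hf0 j i)
    ⟨⟨i, hi⟩, Finset.mem_univ _, lt_of_le_of_ne (hf0 ⟨i, hi⟩ i) (hf ⟨i, hi⟩).symm⟩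

/-- A nonnegative vector of `L^σ` lifts to `L` and, after adding a multiple of a vector of full
support in `σ`, to `L ∩ ℕ^ι`. -/
lemma posSupport_outerLattice [Finite ι] (L : AddSubgroup (ι → ℤ)) :
    posSupport (outerLattice L) = ∅ := by
  refine Set.eq_empty_of_forall_notMem ?_
  rintro ⟨i, hi⟩ ⟨_, ⟨u, hu, rfl⟩, hu0, hui⟩
  obtain ⟨w, hw, hw0, hwpos⟩ := exists_mem_forall_mem_posSupport_pos L
  obtain ⟨N, hN⟩ := exists_nonneg_add_nsmul hw0 hwpos fun j hj => hu0 ⟨j, hj⟩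
  have := eq_zero_of_notMem_posSupport (L.add_mem hu (L.nsmul_mem hw N)) hN hi
  rw [Pi.add_apply, Pi.smul_apply, eq_zero_of_notMem_posSupport hw hw0 hi, smul_zero,
    add_zero] at this
  exact hui this

/-- The sublattice of the vectors of `L` that are supported in `σ_L`. -/
def innerLattice (L : AddSubgroup (ι → ℤ)) : AddSubgroup (ι → ℤ) :=
  L ⊓ (forget (posSupport L)).ker

lemma finrank_outerLattice_add_finrank_innerLattice [Finite ι] (L : AddSubgroup (ι → ℤ)) :
    Module.finrank ℤ (outerLattice L) + Module.finrank ℤ (innerLattice L) = Module.finrank ℤ L :=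
  finrank_map_add_finrank_inf_ker _ L

lemma mem_innerLattice_of_nonneg {L : AddSubgroup (ι → ℤ)} {w : ι → ℤ} (hw : w ∈ L)
    (hw0 : 0 ≤ w) : w ∈ innerLattice L :=
  ⟨hw, funext fun i => eq_zero_of_notMem_posSupport hw hw0 i.2⟩

lemma innerLattice_le_of_forall_nonneg [Finite ι] {L Λ : AddSubgroup (ι → ℤ)}
    (h : ∀ z ∈ L, 0 ≤ z → z ∈ Λ) : innerLattice L ≤ Λ := by
  rintro z ⟨hz, hz0⟩
  obtain ⟨w, hw, hw0, hwpos⟩ := exists_mem_forall_mem_posSupport_pos L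
  obtain ⟨N, hN⟩ := exists_nonneg_add_nsmul hw0 hwpos fun i hi => (congrFun hz0 ⟨i, hi⟩).ge
  rw [← add_sub_cancel_right z (N • w)]
  exact Λ.sub_mem (h _ (L.add_mem hz (L.nsmul_mem hw N)) hN) (Λ.nsmul_mem (h w hw hw0) N)

lemma exists_basis_innerLattice [Finite ι] (L : AddSubgroup (ι → ℤ)) :
    ∃ (b : Module.Basis (Fin (Module.finrank ℤ (innerLattice L))) ℤ (innerLattice L)) (w : ι → ℤ),
      0 ≤ w ∧ (∀ i ∈ posSupport L, 0 < w i) ∧ (w = 0 ∨ ∃ j, b j = w) := by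
  obtain ⟨w, hw, hw0, hwpos⟩ := exists_mem_forall_mem_posSupport_pos L
  rcases eq_or_ne w 0 with rfl | hne
  · exact ⟨Module.finBasis ℤ _, 0, le_rfl, hwpos, .inl rfl⟩
  obtain ⟨b, j, c, hc, hb⟩ := exists_basis_eq_pos_smul
    (w := (⟨w, mem_innerLattice_of_nonneg hw hw0⟩ : innerLattice L))
    (ne_of_apply_ne Subtype.val hne)
  have apply_eq (i : ι) : w i = c * (b j : ι → ℤ) i := congrFun (congrArg Subtype.val hb) i
  refine ⟨b, b j, fun i => ?_, fun i hi => ?_, .inr ⟨j, rfl⟩⟩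
  · exact nonneg_of_mul_nonneg_right ((hw0 i).trans_eq (apply_eq i)) hc
  · exact pos_of_mul_pos_right ((hwpos i hi).trans_eq (apply_eq i)) hc.le

end Lattices

section Restriction

variable {ι : Type*}

/-- The restriction `u ↦ u^s` of exponent vectors to the coordinates outside `s`. Its kernel
consists of the exponent vectors supported in `s`. -/
noncomputable def restrictExp (s : Set ι) : (ι →₀ ℕ) →+ ({i // i ∉ s} →₀ ℕ) :=
  Finsupp.subtypeDomainAddMonoidHom

variable {s : Set ι}

lemma intVec_restrictExp (u : ι →₀ ℕ) : intVec (restrictExp s u) = forget s (intVec u) := rfl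

lemma restrictExp_eq_iff {u v : ι →₀ ℕ} :
    restrictExp s u = restrictExp s v ↔ intVec u - intVec v ∈ (forget s).ker := by
  rw [AddMonoidHom.mem_ker, map_sub, sub_eq_zero, ← intVec_restrictExp, ← intVec_restrictExp,
    intVec_injective.eq_iff]

lemma restrictExp_surjective : Function.Surjective (restrictExp s) := by
  classical
  exact fun a => ⟨a.extendDomain, a.subtypeDomain_extendDomain⟩

lemma latticeCon_restrictExp {L : AddSubgroup (ι → ℤ)} {u v : ι →₀ ℕ} (h : latticeCon L u v) :
    latticeCon (L.map (forget s)) (restrictExp s u) (restrictExp s v) := by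
  rw [latticeCon_iff, intVec_restrictExp, intVec_restrictExp, ← map_sub]
  exact AddSubgroup.mem_map_of_mem _ (latticeCon_iff.1 h)

lemma latticeCon_innerLattice_iff {L : AddSubgroup (ι → ℤ)} {a b : ι →₀ ℕ} :
    latticeCon (innerLattice L) a b ↔ latticeCon L a b ∧
      restrictExp (posSupport L) a = restrictExp (posSupport L) b := by
  rw [latticeCon_iff, latticeCon_iff, restrictExp_eq_iff]
  rfl

variable [Finite ι]

lemma restrictExp_posExp {z : ι → ℤ} (hz : z ∈ (forget s).ker) : restrictExp s (posExp z) = 0 :=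
  Finsupp.ext fun i => Int.toNat_of_nonpos (congrFun hz i).le

lemma exists_intVec_sub_intVec {z : ι → ℤ} (hz : z ∈ (forget s).ker) :
    ∃ c d, restrictExp s c = 0 ∧ restrictExp s d = 0 ∧ intVec c - intVec d = z :=
  ⟨posExp z, posExp (-z), restrictExp_posExp hz, restrictExp_posExp (neg_mem hz),
    intVec_posExp_sub_neg z⟩

lemma exists_restrictExp_eq {L : AddSubgroup (ι → ℤ)} {a b : {i // i ∉ s} →₀ ℕ}
    (h : latticeCon (L.map (forget s)) a b) :
    ∃ u v, restrictExp s u = a ∧ restrictExp s v = b ∧ latticeCon L u v := by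
  obtain ⟨u, rfl⟩ := restrictExp_surjective a
  obtain ⟨v, rfl⟩ := restrictExp_surjective b
  obtain ⟨z, hz, hzuv⟩ := latticeCon_iff.1 h
  obtain ⟨c, d, hc, hd, hcd⟩ := exists_intVec_sub_intVec (s := s) (z := z - (intVec u - intVec v))
    (by rw [AddMonoidHom.mem_ker, map_sub, hzuv, map_sub, intVec_restrictExp, intVec_restrictExp,
      sub_self])
  refine ⟨u + c, v + d, by rw [map_add, hc, add_zero], by rw [map_add, hd, add_zero], ?_⟩
  rwa [latticeCon_iff, map_add, map_add, add_sub_add_comm, hcd, add_sub_cancel]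

end Restriction

section Projection

variable {ι κ : Type*}

/-- For a group `Λ` of integer vectors, the congruence on exponent vectors that is congruence modulo
`Λ` among the vectors supported in `s` and identifies all the others. -/
def faceCon (s : Set ι) (Λ : AddSubgroup (ι → ℤ)) : AddCon (ι →₀ ℕ) where
  r a b := (restrictExp s a = 0 ↔ restrictExp s b = 0) ∧
    (restrictExp s a = 0 → intVec a - intVec b ∈ Λ)
  iseqv :=
    { refl a := ⟨Iff.rfl, fun _ => by rw [sub_self]; exact Λ.zero_mem⟩
      symm {a b} h := ⟨h.1.symm, fun hb => by rw [← neg_sub]; exact Λ.neg_mem (h.2 (h.1.2 hb))⟩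
      trans {a b c} h h' := ⟨h.1.trans h'.1, fun ha => by
        rw [← sub_add_sub_cancel _ (intVec b)]
        exact Λ.add_mem (h.2 ha) (h'.2 (h.1.1 ha))⟩ }
  add' {a b c d} h h' := by
    rw [map_add, map_add, add_eq_zero, add_eq_zero, h.1, h'.1]
    refine ⟨Iff.rfl, fun ⟨hb, hd⟩ => ?_⟩
    rw [map_add, map_add, add_sub_add_comm]
    exact Λ.add_mem (h.2 (h.1.2 hb)) (h'.2 (h'.1.2 hd))

variable [Finite ι] {L : AddSubgroup (ι → ℤ)} {u v : κ → ι →₀ ℕ}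

lemma restrictExp_eq_zero_of_latticeCon {a b : ι →₀ ℕ} (h : latticeCon L a b)
    (ha : restrictExp (posSupport L) a = 0) : restrictExp (posSupport L) b = 0 := by
  refine eq_zero_of_intVec_mem (posSupport_outerLattice L) ?_
  have := latticeCon_iff.1 (latticeCon_restrictExp (s := posSupport L) ((latticeCon L).symm h))
  rwa [ha, map_zero, sub_zero] at this

lemma innerLattice_le_closure (h : latticeCon L = pairCon u v) :
    innerLattice L ≤ AddSubgroup.closure (Set.range
      fun j : {j // latticeCon (innerLattice L) (u j) (v j)} => intVec (u j) - intVec (v j)) := by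
  set Λ := AddSubgroup.closure (Set.range
    fun j : {j // latticeCon (innerLattice L) (u j) (v j)} => intVec (u j) - intVec (v j))
  have latticeCon_le_faceCon : latticeCon L ≤ faceCon (posSupport L) Λ := by
    rw [h, pairCon_le_iff]
    intro j
    have huv : latticeCon L (u j) (v j) := h ▸ pairCon_apply u v j
    have restrict_iff :
        restrictExp (posSupport L) (u j) = 0 ↔ restrictExp (posSupport L) (v j) = 0 :=
      ⟨restrictExp_eq_zero_of_latticeCon huv, restrictExp_eq_zero_of_latticeCon (AddCon.symm _ huv)⟩
    refine ⟨restrict_iff, fun hu => AddSubgroup.subset_closure ⟨⟨j, ?_⟩, rfl⟩⟩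
    exact latticeCon_innerLattice_iff.2 ⟨huv, hu.trans (restrict_iff.1 hu).symm⟩
  refine innerLattice_le_of_forall_nonneg fun z hz hz0 => ?_
  have hz_zero : faceCon (posSupport L) Λ (posExp z) 0 := latticeCon_le_faceCon <| by
    rwa [latticeCon_iff, intVec_posExp hz0, map_zero, sub_zero]
  have := hz_zero.2 (hz_zero.1.2 (map_zero _))
  rwa [intVec_posExp hz0, map_zero, sub_zero] at this

lemma latticeCon_outerLattice_eq_pairCon (h : latticeCon L = pairCon u v) :
    latticeCon (outerLattice L) = pairCon
      (fun j : {j // ¬latticeCon (innerLattice L) (u j) (v j)} => restrictExp (posSupport L) (u j))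
      (fun j => restrictExp (posSupport L) (v j)) := by
  have huv (j) : latticeCon L (u j) (v j) := h ▸ pairCon_apply u v j
  refine le_antisymm ?_ (pairCon_le_iff.2 fun j => latticeCon_restrictExp (huv j))
  set r := pairCon
    (fun j : {j // ¬latticeCon (innerLattice L) (u j) (v j)} => restrictExp (posSupport L) (u j))
    (fun j => restrictExp (posSupport L) (v j))
  have latticeCon_le_comap : latticeCon L ≤ r.comap (restrictExp (posSupport L)) (map_add _) := by
    rw [h, pairCon_le_iff]
    intro j
    rw [AddCon.comap_rel]
    by_cases hj : latticeCon (innerLattice L) (u j) (v j)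
    · rw [(latticeCon_innerLattice_iff.1 hj).2]
      exact r.refl _
    · exact pairCon_apply _ _ (⟨j, hj⟩ : {j // ¬latticeCon (innerLattice L) (u j) (v j)})
  intro a b hab
  obtain ⟨x, y, rfl, rfl, hxy⟩ := exists_restrictExp_eq hab
  exact latticeCon_le_comap hxy

lemma isGeneratedByPairs_latticeCon_outerLattice
    (h : IsGeneratedByPairs (latticeCon L) (Module.finrank ℤ L)) :
    IsGeneratedByPairs (latticeCon (outerLattice L)) (Module.finrank ℤ (outerLattice L)) := by
  classical
  obtain ⟨u, v, h⟩ := h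
  rw [latticeCon_outerLattice_eq_pairCon h]
  refine isGeneratedByPairs_pairCon ?_ _ _
  have card_inner := finrank_le_card_of_le_closure (innerLattice_le_closure h)
  have card_add_card := Nat.card_congr
    (Equiv.sumCompl fun j => latticeCon (innerLattice L) (u j) (v j))
  rw [Nat.card_sum, Nat.card_fin] at card_add_card
  have finrank_add_finrank := finrank_outerLattice_add_finrank_innerLattice L
  omega

end Projection

section Lifting

variable {ι κ : Type*}

/-- The smallest congruence that contains `r` and identifies the elements of `F` with `0`. -/
def collapseCon {M : Type*} [AddCommMonoid M] (r : AddCon M) (F : AddSubmonoid M) : AddCon M where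
  r x y := ∃ c ∈ F, ∃ d ∈ F, r (x + c) (y + d)
  iseqv :=
    { refl x := ⟨0, F.zero_mem, 0, F.zero_mem, r.refl _⟩
      symm := fun ⟨c, hc, d, hd, h⟩ => ⟨d, hd, c, hc, r.symm h⟩
      trans {x y z} := fun ⟨c, hc, d, hd, h⟩ ⟨c', hc', d', hd', h'⟩ => by
        refine ⟨c + c', F.add_mem hc hc', d' + d, F.add_mem hd' hd, ?_⟩
        rw [← add_assoc, ← add_assoc]
        refine r.trans (r.add h (r.refl c')) ?_
        rw [add_right_comm]
        exact r.add h' (r.refl d) }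
  add' := fun ⟨c, hc, d, hd, h⟩ ⟨c', hc', d', hd', h'⟩ => by
    refine ⟨c + c', F.add_mem hc hc', d + d', F.add_mem hd hd', ?_⟩
    rw [add_add_add_comm, add_add_add_comm _ _ d]
    exact r.add h h'

variable [Finite ι] {s : Set ι} {L : AddSubgroup (ι → ℤ)} {u v : κ → ι →₀ ℕ}
  {r : AddCon (ι →₀ ℕ)}

lemma ker_restrictExp_le_collapseCon :
    AddCon.ker (restrictExp s) ≤ collapseCon r (AddMonoidHom.mker (restrictExp s)) := by
  intro x y hxy
  obtain ⟨c, d, hc, hd, hcd⟩ := exists_intVec_sub_intVec (restrictExp_eq_iff.1 hxy.symm)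
  have add_eq_add : x + c = y + d := intVec_injective <| by
    rw [map_add, map_add, add_comm, sub_eq_sub_iff_add_eq_add.1 hcd]
  exact ⟨c, hc, d, hd, add_eq_add ▸ r.refl _⟩

lemma latticeCon_le_collapseCon
    (h : latticeCon (L.map (forget s)) =
      pairCon (fun j => restrictExp s (u j)) fun j => restrictExp s (v j))
    (hr : pairCon u v ≤ r) :
    latticeCon L ≤ collapseCon r (AddMonoidHom.mker (restrictExp s)) := by
  set t := collapseCon r (AddMonoidHom.mker (restrictExp s))
  have hker : AddCon.ker (restrictExp s) ≤ t := ker_restrictExp_le_collapseCon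
  have latticeCon_map_le : latticeCon (L.map (forget s)) ≤
      t.mapOfSurjective (restrictExp s) hker restrictExp_surjective := by
    rw [h, pairCon_le_iff]
    refine fun j => ⟨u j, v j, ⟨0, zero_mem _, 0, zero_mem _, ?_⟩, rfl, rfl⟩
    simpa only [add_zero] using pairCon_le_iff.1 hr j
  intro x y hxy
  obtain ⟨x', y', h', hx, hy⟩ := latticeCon_map_le (latticeCon_restrictExp hxy)
  exact t.trans (hker hx.symm) (t.trans h' (hker hy))

/-- A multiple of `w` dominates `c`, so that `c` becomes invertible modulo `r`. -/
lemma rel_of_add_right {w : ι → ℤ} (hw : 0 ≤ w) (hws : ∀ i ∈ s, 0 < w i) (hr : r (posExp w) 0)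
    {c : ι →₀ ℕ} (hc : restrictExp s c = 0) {x y : ι →₀ ℕ} (h : r (x + c) (y + c)) : r x y := by
  obtain ⟨N, hN⟩ := exists_nonneg_add_nsmul (s := s) (u := -intVec c) hw hws fun i hi => by
    have : c i = 0 := DFunLike.congr_fun hc ⟨i, hi⟩
    simp [this]
  obtain ⟨d, hd⟩ : ∃ d, c + d = N • posExp w := ⟨posExp (-intVec c + N • w), intVec_injective <| by
    rw [map_add, intVec_posExp hN, map_nsmul, intVec_posExp hw, add_neg_cancel_left]⟩
  have hcd (z : ι →₀ ℕ) : r (z + c + d) z := by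
    have := r.add (r.refl z) (r.nsmul N hr)
    rwa [← hd, ← add_assoc, nsmul_zero, add_zero] at this
  exact r.trans (r.symm (hcd x)) (r.trans (r.add h (r.refl d)) (hcd y))

/-- The binomials of an arbitrary basis only generate up to saturation with respect to the variables
in `σ`; a basis vector of full support makes these variables invertible. -/
lemma isGeneratedByPairs_latticeCon_innerLattice (L : AddSubgroup (ι → ℤ)) :
    IsGeneratedByPairs (latticeCon (innerLattice L)) (Module.finrank ℤ (innerLattice L)) := by
  obtain ⟨b, w, hw, hwpos, hwb⟩ := exists_basis_innerLattice L
  let r := pairCon (fun j => posExp (b j)) fun j => posExp (-(b j : ι → ℤ))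
  have hr (j) : r (posExp (b j)) (posExp (-(b j : ι → ℤ))) := pairCon_apply _ _ j
  refine ⟨_, _, le_antisymm (b := r) ?_ ?_⟩
  · have hwr : r (posExp w) 0 := by
      rcases hwb with rfl | ⟨j, rfl⟩
      · rw [posExp_of_nonpos le_rfl]
        exact r.refl 0
      · rw [← posExp_of_nonpos (neg_nonpos.2 hw)]
        exact hr j
    intro x y hxy
    rw [latticeCon_iff, ← closure_range_basis b] at hxy
    refine rel_of_sub_mem_closure (M := AddMonoidHom.mker (restrictExp (posSupport L)))
      (fun c hc x y => rel_of_add_right hw hwpos hwr hc) ?_ hxy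
    rintro _ ⟨j, rfl⟩
    exact ⟨_, restrictExp_posExp (b j).2.2, _, restrictExp_posExp (neg_mem (b j).2.2),
      intVec_posExp_sub_neg _, hr j⟩
  · refine pairCon_le_iff.2 fun j => ?_
    rw [latticeCon_iff, intVec_posExp_sub_neg]
    exact (b j).2

lemma latticeCon_eq_pairCon_sup (huv : ∀ j, latticeCon L (u j) (v j))
    (h : latticeCon (outerLattice L) = pairCon (fun j => restrictExp (posSupport L) (u j))
      fun j => restrictExp (posSupport L) (v j)) :
    latticeCon L = pairCon u v ⊔ latticeCon (innerLattice L) := by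
  have hle : pairCon u v ⊔ latticeCon (innerLattice L) ≤ latticeCon L :=
    sup_le (pairCon_le_iff.2 huv) (latticeCon_mono inf_le_left)
  refine le_antisymm (fun x y hxy => ?_) hle
  set r := pairCon u v ⊔ latticeCon (innerLattice L)
  obtain ⟨w, hw, hw0, hwpos⟩ := exists_mem_forall_mem_posSupport_pos L
  have hwr : r (posExp w) 0 := (le_sup_right : _ ≤ r) <| by
    rw [latticeCon_iff, intVec_posExp hw0, map_zero, sub_zero]
    exact mem_innerLattice_of_nonneg hw hw0
  obtain ⟨c, hc, d, hd, hcd⟩ := latticeCon_le_collapseCon h le_sup_left hxy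
  have hcd_inner : latticeCon (innerLattice L) c d := by
    refine latticeCon_innerLattice_iff.2 ⟨?_, hc.trans hd.symm⟩
    have := L.sub_mem (latticeCon_iff.1 (hle hcd)) (latticeCon_iff.1 hxy)
    rw [map_add, map_add, add_sub_add_comm, add_sub_cancel_left] at this
    exact latticeCon_iff.2 this
  refine rel_of_add_right hw0 hwpos hwr hc (r.trans hcd ?_)
  exact r.add (r.refl y) (r.symm ((le_sup_right : _ ≤ r) hcd_inner))

lemma isGeneratedByPairs_latticeCon_of_outerLattice
    (h : IsGeneratedByPairs (latticeCon (outerLattice L)) (Module.finrank ℤ (outerLattice L))) :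
    IsGeneratedByPairs (latticeCon L) (Module.finrank ℤ L) := by
  obtain ⟨a, b, h⟩ := h
  choose u v hu hv huv using fun j => exists_restrictExp_eq (h ▸ pairCon_apply a b j)
  rw [latticeCon_eq_pairCon_sup huv (by simpa only [hu, hv] using h)]
  have huv_gen : IsGeneratedByPairs (pairCon u v) _ := ⟨u, v, rfl⟩
  have := huv_gen.sup (isGeneratedByPairs_latticeCon_innerLattice L)
  rwa [finrank_outerLattice_add_finrank_innerLattice] at this

theorem isGeneratedByPairs_latticeCon_iff_outerLattice :
    IsGeneratedByPairs (latticeCon L) (Module.finrank ℤ L) ↔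
      IsGeneratedByPairs (latticeCon (outerLattice L)) (Module.finrank ℤ (outerLattice L)) :=
  ⟨isGeneratedByPairs_latticeCon_outerLattice, isGeneratedByPairs_latticeCon_of_outerLattice⟩

end Lifting

section CompleteIntersection

variable {ι k : Type*}

lemma IsBinomialCompleteIntersection.isCompleteIntersection [CommRing k]
    {I : Ideal (MvPolynomial ι k)} (h : IsBinomialCompleteIntersection I) :
    IsCompleteIntersection I := by
  obtain ⟨r, B, -, hr, hI⟩ := h
  exact ⟨r, B, hr, hI⟩

variable [Finite ι] [Field k] {L : AddSubgroup (ι → ℤ)}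

lemma isBinomialCompleteIntersection_latticeIdeal_iff :
    IsBinomialCompleteIntersection (latticeIdeal k L) ↔
      IsGeneratedByPairs (latticeCon L) (Module.finrank ℤ L) := by
  rw [IsBinomialCompleteIntersection, height_latticeIdeal]
  constructor
  · rintro ⟨r, B, hB, hr, hI⟩
    choose u v huv using hB
    obtain rfl : B = fun j => binomial k (u j) (v j) := funext huv
    rw [Nat.cast_inj.1 hr]
    rw [latticeIdeal_eq_conIdeal, span_range_binomial] at hI
    exact ⟨u, v, conIdeal_injective hI⟩
  · rintro ⟨u, v, h⟩
    refine ⟨_, fun j => binomial k (u j) (v j), fun j => ⟨u j, v j, rfl⟩, rfl, ?_⟩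
    rw [latticeIdeal_eq_conIdeal, span_range_binomial, h]

lemma isCompleteIntersection_latticeIdeal_iff (hL : posSupport L = ∅) :
    IsCompleteIntersection (latticeIdeal k L) ↔
      IsGeneratedByPairs (latticeCon L) (Module.finrank ℤ L) := by
  constructor
  · rintro ⟨r, P, hr, hI⟩
    rw [height_latticeIdeal] at hr
    rw [Nat.cast_inj.1 hr]
    exact isGeneratedByPairs_latticeCon_of_posSupport_eq_empty hL hI
  · intro h
    exact (isBinomialCompleteIntersection_latticeIdeal_iff.2 h).isCompleteIntersection

end CompleteIntersection

end LatticeIdeal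

theorem theorem5p5_general {ι k : Type*} [Finite ι] [Field k] (L : AddSubgroup (ι → ℤ)) :
    LatticeIdeal.IsBinomialCompleteIntersection (LatticeIdeal.latticeIdeal k L) ↔
      LatticeIdeal.IsCompleteIntersection
        (LatticeIdeal.latticeIdeal k (LatticeIdeal.outerLattice L)) := by
  rw [LatticeIdeal.isBinomialCompleteIntersection_latticeIdeal_iff,
    LatticeIdeal.isCompleteIntersection_latticeIdeal_iff (LatticeIdeal.posSupport_outerLattice L),
    LatticeIdeal.isGeneratedByPairs_latticeCon_iff_outerLattice]

theorem theorem5p5 {k : Type*} [Field k] (n : ℕ) (L : AddSubgroup (Fin n → ℤ)) :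
    LatticeIdeal.IsBinomialCompleteIntersection (LatticeIdeal.latticeIdeal k L) ↔
      LatticeIdeal.IsCompleteIntersection
        (LatticeIdeal.latticeIdeal k (LatticeIdeal.outerLattice L)) :=
  theorem5p5_general L
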